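/- Let $c>0$, $\lambda>0$. Let $N=(N(t))_{t\ge 0}$ be a homogeneous Poisson process with rate $\lambda$, and let $V(0)$ be a random variable independent of $N$ with $P\{V(0)=c\}=P\{V(0)=-c\}=\tfrac12$. Let $$\mathcal T(t)=\int_0^t V(0)(-1)^{N(s)}\,ds,\qquad t\ge 0,$$ be the symmetric telegraph process. Then for every $t>0$ and every integer $k\ge 0$, $$P\Bigl\{\max_{0\le s\le t}\mathcal T(s)\in d\beta \,\Big|\, V(0)=c,\ N(t)=2k+2\Bigr\}=P\Bigl\{\max_{0\le s\le t}\mathcal T(s)\in d\beta \,\Big|\, V(0)=c,\ N(t)=2k+1\Bigr\}=2\,\frac{(2k+1)!}{(k!)^2}\,\frac{(c^2t^2-\beta^2)^k}{(2ct)^{2k+1}}\,d\beta,\qquad 0<\beta<ct;$$ that is, both conditional laws of the maximum are absolutely continuous, carried by $(0,ct)$, with this density there. Moreover $$P\Bigl\{\max_{0\le s\le t}\mathcal T(s)=ct \,\Big|\, V(0)=c,\ N(t)=0\Bigr\}=1 .$$ -/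

import Mathlib

open MeasureTheory ProbabilityTheory Set
open scoped NNReal ENNReal Nat

namespace Telegraph

/-- `N` is a homogeneous Poisson process with rate `r`: a counting process (started at `0`, with
nondecreasing right-continuous paths) with independent increments, such that `N t - N s` is Poisson
distributed with mean `r * (t - s)` for `s ≤ t`. -/
structure IsPoissonProcess {Ω : Type*} [MeasurableSpace Ω]
    (r : ℝ≥0) (N : ℝ≥0 → Ω → ℕ) (P : Measure Ω) : Prop where
  measurable : ∀ t, Measurable (N t)
  zero : ∀ ω, N 0 ω = 0
  mono : ∀ ω, Monotone fun t => N t ω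
  rightCont : ∀ ω t, ContinuousWithinAt (fun s => N s ω) (Ici t) t
  indepIncrements : HasIndepIncrements N P
  law_sub : ∀ s t, s ≤ t →
    HasLaw (fun ω => N t ω - N s ω) (poissonMeasure (r * (t - s))) P

/-- The initial velocity is a symmetric random variable with the two values `c` and `-c`. -/
structure IsSymmetricVelocity {Ω : Type*} [MeasurableSpace Ω]
    (c : ℝ) (V : Ω → ℝ) (P : Measure Ω) : Prop where
  measurable : Measurable V
  prob_pos : P {ω | V ω = c} = 1 / 2
  prob_neg : P {ω | V ω = -c} = 1 / 2

/-- The telegraph process `T(t) = ∫₀ᵗ V(0) (-1)^{N(s)} ds`. -/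
noncomputable def position {Ω : Type*} (V : Ω → ℝ) (N : ℝ≥0 → Ω → ℕ) (t : ℝ≥0) (ω : Ω) : ℝ :=
  ∫ s in (0 : ℝ)..t, V ω * (-1) ^ N s.toNNReal ω

/-- `max_{0 ≤ s ≤ t} T(s)`; see `isGreatest_runningMax`. -/
noncomputable def runningMax {Ω : Type*} (V : Ω → ℝ) (N : ℝ≥0 → Ω → ℕ) (t : ℝ≥0) (ω : Ω) : ℝ :=
  sSup ((fun s : ℝ≥0 => position V N s ω) '' Icc 0 t)

theorem continuous_position {Ω : Type*} (V : Ω → ℝ) (N : ℝ≥0 → Ω → ℕ) (ω : Ω)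
    (hN : Monotone fun t => N t ω) : Continuous fun t : ℝ≥0 => position V N t ω := by
  have hm : Measurable fun s : ℝ => V ω * (-1 : ℝ) ^ N s.toNNReal ω := by
    have h1 : Measurable fun s : ℝ => N s.toNNReal ω := hN.measurable.comp measurable_real_toNNReal
    exact ((measurable_of_countable fun n : ℕ => (-1 : ℝ) ^ n).comp h1).const_mul _
  have hi : ∀ a b : ℝ, IntervalIntegrable (fun s : ℝ => V ω * (-1 : ℝ) ^ N s.toNNReal ω)
      volume a b := fun a b => by
    refine (intervalIntegrable_const (c := |V ω|)).mono_fun hm.aestronglyMeasurable ?_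
    exact Filter.Eventually.of_forall fun s => by simp
  exact (intervalIntegral.continuous_primitive hi 0).comp NNReal.continuous_coe

/-- Along nondecreasing paths of `N` the supremum defining `runningMax` is an attained maximum. -/
theorem isGreatest_runningMax {Ω : Type*} (V : Ω → ℝ) (N : ℝ≥0 → Ω → ℕ) (t : ℝ≥0) (ω : Ω)
    (hN : Monotone fun t => N t ω) :
    IsGreatest ((fun s : ℝ≥0 => position V N s ω) '' Icc 0 t) (runningMax V N t ω) :=
  (isCompact_Icc.image (continuous_position V N ω hN)).isGreatest_sSup
    ((nonempty_Icc.2 (zero_le)).image _)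

/-- The law on `(0, ct)` with density
`2 (2k+1)! / (k!)² * (c² t² - β²)^k / (2ct)^(2k+1)`. -/
noncomputable def maxLaw (c t : ℝ) (k : ℕ) : Measure ℝ :=
  (volume.restrict (Ioo 0 (c * t))).withDensity fun β => ENNReal.ofReal
    (2 * (((2 * k + 1)! : ℕ) / (k ! : ℝ) ^ 2) *
      ((c ^ 2 * t ^ 2 - β ^ 2) ^ k / (2 * c * t) ^ (2 * k + 1)))

end Telegraph

/-!
The idea is to compute, for a motion of speed `1` and a fixed number `n` of jumps, the probability
of staying below a level `b` up to time `t` as a function of `(t, b)`. Multiplied by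
`exp (r t) / r ^ n`, this probability (`stayVolume`) is the volume of the jump times that keep the
motion below `b`.

Restarting the Poisson process at a small time `h` gives a Poisson process independent of `N h`
(`IsPoissonProcess.indepFun_shift`). Up to an error of order `h²`, either there is no jump before
`h`, and the level is shifted by the distance `h` covered, or there is one, and the motion goes on
with opposite velocity and one jump less (`le_stayVolume_add`, `stayVolume_add_le`). In the limit,
the volumes `up n` and `down n` for the two initial directions solve the transport equations
`(∂ₜ + ∂_b) up (n + 1) = down n` and `(∂ₜ - ∂_b) down (n + 1) = up n`
(`stayVolume_eq_along_characteristic`). The characteristics of the first start at level `0`, where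
`up (n + 1)` vanishes because an upward start leaves the level `0` at once; those of the second
start on the diagonal `b = t`, where the level is no constraint and the volume is `tⁿ / n!`.

The equations are solved by explicit functions (`upVolume`, `downVolume`) built from
`∫₀ᵇ (t² - x²)ᵏ dx`, whose recursion in `k` is integration by parts. Only the explicit solution is
compared with the probability, for all Poisson processes at once, by induction on `n`
(`stayVolume_eq`). The volumes for `2k + 1` and `2k + 2` jumps are the same fraction of the volume
of all jump times (`upVolume_div`), and this fraction is the distribution function of `maxLaw`.
-/

namespace Telegraph

/-! ### Paths of the telegraph process -/

section Path

variable {Ω : Type*} {V : Ω → ℝ} {N : ℝ≥0 → Ω → ℕ} {ω : Ω}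

/-- The counting process restarted at time `a`. -/
def shift (a : ℝ≥0) (N : ℝ≥0 → Ω → ℕ) : ℝ≥0 → Ω → ℕ := fun s ω => N (s + a) ω - N a ω

theorem shift_zero (h0 : ∀ ω, N 0 ω = 0) : shift 0 N = N := by
  funext s ω
  simp [shift, h0]

theorem shift_shift (hN : ∀ ω, Monotone fun t => N t ω) (a b : ℝ≥0) :
    shift b (shift a N) = shift (a + b) N := by
  funext s ω
  have h1 : N a ω ≤ N (b + a) ω := hN ω le_add_self
  have h2 : N (b + a) ω ≤ N (s + b + a) ω := hN ω (by rw [add_assoc]; exact le_add_self)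
  have e : s + b + a = s + (b + a) := add_assoc s b a
  rw [e] at h2
  simp only [shift, e, add_comm a b]
  omega

theorem shift_mono (hN : Monotone fun t => N t ω) (a : ℝ≥0) :
    Monotone fun t => shift a N t ω := fun _ _ h =>
  Nat.sub_le_sub_right (hN (by gcongr)) _

theorem intervalIntegrable_velocity (hN : Monotone fun t => N t ω) (v a b : ℝ) :
    IntervalIntegrable (fun s : ℝ => v * (-1 : ℝ) ^ N s.toNNReal ω) volume a b := by
  have hm : Measurable fun s : ℝ => v * (-1 : ℝ) ^ N s.toNNReal ω := by
    have h1 : Measurable fun s : ℝ => N s.toNNReal ω := hN.measurable.comp measurable_real_toNNReal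
    exact ((measurable_of_countable fun n : ℕ => (-1 : ℝ) ^ n).comp h1).const_mul _
  refine (intervalIntegrable_const (c := |v|)).mono_fun hm.aestronglyMeasurable ?_
  exact Filter.Eventually.of_forall fun s => by simp

theorem position_zero : position V N 0 ω = 0 := by simp [position]

theorem abs_position_le (t : ℝ≥0) : |position V N t ω| ≤ |V ω| * t := by
  have := intervalIntegral.norm_integral_le_of_norm_le_const (a := 0) (b := t)
    (f := fun s : ℝ => V ω * (-1 : ℝ) ^ N s.toNNReal ω) (C := |V ω|) (fun s _ => by simp)
  simpa [position] using this

/-- Restarting at time `h` turns the velocity into `v * (-1) ^ N h`. -/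
theorem position_add (hN : Monotone fun t => N t ω) (v : ℝ) (h s : ℝ≥0) :
    position (fun _ => v) N (h + s) ω =
      position (fun _ => v) N h ω +
        position (fun _ => v * (-1) ^ N h ω) (shift h N) s ω := by
  simp only [position]
  rw [NNReal.coe_add, ← intervalIntegral.integral_add_adjacent_intervals
    (intervalIntegrable_velocity hN v 0 h) (intervalIntegrable_velocity hN v h (h + s))]
  congr 1
  have h1 := intervalIntegral.integral_comp_add_right (a := 0) (b := (s : ℝ))
    (fun u : ℝ => v * (-1 : ℝ) ^ N u.toNNReal ω) (h : ℝ)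
  rw [zero_add, add_comm (s : ℝ)] at h1
  rw [← h1]
  refine intervalIntegral.integral_congr fun u hu => ?_
  rw [uIcc_of_le s.coe_nonneg] at hu
  have e : (u + h).toNNReal = u.toNNReal + h := by
    rw [Real.toNNReal_add hu.1 h.coe_nonneg, Real.toNNReal_coe]
  simp only [shift, e]
  rw [mul_assoc, ← pow_add, Nat.add_sub_cancel' (hN le_add_self)]

theorem position_eq_mul_of_eq_zero (hN : Monotone fun t => N t ω) {h s : ℝ≥0} (hs : s ≤ h)
    (h0 : N h ω = 0) : position V N s ω = V ω * s := by
  have : position V N s ω = ∫ _ in (0 : ℝ)..s, V ω := by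
    refine intervalIntegral.integral_congr fun u hu => ?_
    rw [uIcc_of_le s.coe_nonneg] at hu
    have : N u.toNNReal ω = 0 := by
      have := hN ((Real.toNNReal_le_iff_le_coe.2 hu.2).trans hs)
      simp only at this
      omega
    simp [this]
  rw [this]
  simp [mul_comm]

theorem runningMax_le_iff (hN : Monotone fun t => N t ω) (t : ℝ≥0) (b : ℝ) :
    runningMax V N t ω ≤ b ↔ ∀ s ≤ t, position V N s ω ≤ b := by
  rw [isLUB_le_iff (isGreatest_runningMax V N t ω hN).isLUB]
  simp [upperBounds]

theorem runningMax_nonneg (hN : Monotone fun t => N t ω) (t : ℝ≥0) :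
    0 ≤ runningMax V N t ω := by
  have := (runningMax_le_iff hN t _).1 (le_refl (runningMax V N t ω)) 0 zero_le
  rwa [position_zero] at this

theorem runningMax_le_mul (hN : Monotone fun t => N t ω) (t : ℝ≥0) :
    runningMax V N t ω ≤ |V ω| * t :=
  (runningMax_le_iff hN t _).2 fun s hs =>
    (le_abs_self _).trans ((abs_position_le s).trans (by gcongr))

/-- The path up to time `h + t` stays below `b` iff it does so up to time `h` and the path
restarted at time `h` stays below `b - position h`. -/
theorem runningMax_add_le_iff (hN : Monotone fun t => N t ω) (v : ℝ) (h t : ℝ≥0) (b : ℝ) :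
    runningMax (fun _ => v) N (h + t) ω ≤ b ↔
      runningMax (fun _ => v) N h ω ≤ b ∧
      runningMax (fun _ => v * (-1) ^ N h ω) (shift h N) t ω ≤
        b - position (fun _ => v) N h ω := by
  rw [runningMax_le_iff hN, runningMax_le_iff hN, runningMax_le_iff (shift_mono hN h)]
  constructor
  · intro H
    refine ⟨fun s hs => H s (hs.trans le_self_add), fun s hs => ?_⟩
    have := H (h + s) (by gcongr)
    rw [position_add hN] at this
    linarith
  · rintro ⟨H1, H2⟩ s hs
    rcases le_total s h with hsh | hsh
    · exact H1 s hsh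
    · have := H2 (s - h) (tsub_le_iff_left.2 hs)
      rw [← add_tsub_cancel_of_le hsh, position_add hN]
      linarith

end Path

/-! ### Measurability of the path functionals -/

section Measurability

variable {Ω : Type*} {m : MeasurableSpace Ω} {V : Ω → ℝ} {N : ℝ≥0 → Ω → ℕ}

open Filter Topology in
/-- Right-continuity makes the counting process jointly measurable in time and `ω`: it is the
limit of its values at the next point of the grid of mesh `1 / (j + 1)`. -/
theorem measurable_uncurry_of_rightCont (hm : ∀ t, Measurable (N t))
    (hc : ∀ ω t, ContinuousWithinAt (fun s => N s ω) (Ici t) t) :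
    Measurable fun p : Ω × ℝ≥0 => N p.2 p.1 := by
  let fl : ℕ → ℝ≥0 → ℕ := fun j u => ⌊u * (j + 1)⌋₊
  have hlim (u : ℝ≥0) : Tendsto (fun j : ℕ => ((fl j u : ℝ≥0) + 1) / (j + 1)) atTop
      (𝓝[≥] u) := by
    have hge (j : ℕ) : u ≤ ((fl j u : ℝ≥0) + 1) / (j + 1) := by
      rw [le_div_iff₀ (by positivity)]
      exact (Nat.lt_floor_add_one _).le
    refine tendsto_nhdsWithin_iff.2 ⟨?_, Eventually.of_forall hge⟩
    have h1 : Tendsto (fun j : ℕ => u + 1 / ((j : ℝ≥0) + 1)) atTop (𝓝 u) := by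
      simpa using tendsto_const_nhds.add (tendsto_one_div_add_atTop_nhds_zero_nat (𝕜 := ℝ≥0))
    refine tendsto_of_tendsto_of_tendsto_of_le_of_le tendsto_const_nhds h1 hge fun j => ?_
    rw [div_le_iff₀ (by positivity), add_mul, one_div, inv_mul_cancel₀ (by positivity)]
    gcongr
    exact Nat.floor_le zero_le
  have hgrid (j : ℕ) : Measurable (fl j) :=
    Nat.measurable_floor.comp (measurable_id.mul_const _)
  clear_value fl
  have hmeas (j : ℕ) : Measurable fun p : Ω × ℝ≥0 =>
      N (((fl j p.2 : ℕ) + 1 : ℝ≥0) / (j + 1)) p.1 := by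
    have h1 : Measurable fun q : Ω × ℕ => N (((q.2 : ℝ≥0) + 1) / (j + 1)) q.1 :=
      measurable_from_prod_countable_left
        fun k => (hm _ : Measurable (N (((k : ℝ≥0) + 1) / (j + 1))))
    have h2 : Measurable fun p : Ω × ℝ≥0 => (p.1, fl j p.2) :=
      measurable_fst.prodMk ((hgrid j).comp measurable_snd)
    have h3 := h1.comp h2
    exact h3
  exact measurable_of_tendsto_metrizable hmeas
    (tendsto_pi_nhds.2 fun p => (hc p.1 p.2).tendsto.comp (hlim p.2))

theorem measurable_position (hV : Measurable V) (hm : ∀ t, Measurable (N t))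
    (hc : ∀ ω t, ContinuousWithinAt (fun s => N s ω) (Ici t) t) (t : ℝ≥0) :
    Measurable (position V N t) := by
  have h1 : Measurable fun p : Ω × ℝ => V p.1 * (-1 : ℝ) ^ N p.2.toNNReal p.1 := by
    refine (hV.comp measurable_fst).mul
      ((measurable_of_countable fun n : ℕ => (-1 : ℝ) ^ n).comp ?_)
    exact (measurable_uncurry_of_rightCont hm hc).comp
      (measurable_fst.prodMk (measurable_real_toNNReal.comp measurable_snd))
  have h2 : position V N t = fun ω => ∫ s in Ioc (0 : ℝ) t, V ω * (-1) ^ N s.toNNReal ω := by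
    funext ω
    exact intervalIntegral.integral_of_le t.coe_nonneg
  rw [h2]
  exact (h1.stronglyMeasurable.integral_prod_right').measurable

theorem measurable_runningMax (hV : Measurable V) (hm : ∀ t, Measurable (N t))
    (hN : ∀ ω, Monotone fun t => N t ω)
    (hc : ∀ ω t, ContinuousWithinAt (fun s => N s ω) (Ici t) t) (t : ℝ≥0) :
    Measurable (runningMax V N t) := by
  refine measurable_of_Iic fun b => ?_
  have : runningMax V N t ⁻¹' Iic b =
      ⋂ j : ℕ, {ω | position V N (min (TopologicalSpace.denseSeq ℝ≥0 j) t) ω ≤ b} := by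
    ext ω
    simp only [mem_preimage, mem_Iic, runningMax_le_iff (hN ω), mem_iInter, mem_ofPred_eq]
    refine ⟨fun H j => H _ (min_le_right _ _), fun H s hs => ?_⟩
    have hcl : IsClosed {s : ℝ≥0 | position V N (min s t) ω ≤ b} :=
      isClosed_le ((continuous_position V N ω (hN ω)).comp (continuous_id.min continuous_const))
        continuous_const
    have := hcl.closure_subset_iff.2 (range_subset_iff.2 H)
      ((TopologicalSpace.denseRange_denseSeq ℝ≥0) s)
    simpa [min_eq_left hs] using this
  rw [this]
  exact MeasurableSet.iInter fun j =>
    measurableSet_le (measurable_position hV hm hc _) measurable_const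

/-- The event that the counter reads `n` at time `t` while the motion with initial velocity `v`
has stayed below the level `b` up to time `t`. -/
def stayBelow (v : ℝ) (N : ℝ≥0 → Ω → ℕ) (n : ℕ) (t : ℝ≥0) (b : ℝ) : Set Ω :=
  {ω | N t ω = n ∧ runningMax (fun _ => v) N t ω ≤ b}

theorem measurableSet_stayBelow (hm : ∀ t, Measurable (N t))
    (hN : ∀ ω, Monotone fun t => N t ω)
    (hc : ∀ ω t, ContinuousWithinAt (fun s => N s ω) (Ici t) t) (v : ℝ) (n : ℕ) (t : ℝ≥0)
    (b : ℝ) : MeasurableSet (stayBelow v N n t b) :=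
  (hm t (measurableSet_singleton n)).inter
    (measurableSet_le (measurable_runningMax measurable_const hm hN hc t) measurable_const)

/-- The event is determined by the counting process alone. -/
theorem measurableSet_comap_stayBelow
    (hN : ∀ ω, Monotone fun t => N t ω)
    (hc : ∀ ω t, ContinuousWithinAt (fun s => N s ω) (Ici t) t) (v : ℝ) (n : ℕ) (t : ℝ≥0)
    (b : ℝ) :
    MeasurableSet[MeasurableSpace.comap (fun ω s => N s ω) MeasurableSpace.pi]
      (stayBelow v N n t b) := by
  let _ : MeasurableSpace Ω := MeasurableSpace.comap (fun ω s => N s ω) MeasurableSpace.pi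
  refine measurableSet_stayBelow (fun s => ?_) hN hc v n t b
  exact (measurable_pi_apply s).comp (comap_measurable fun ω (s : ℝ≥0) => N s ω)

end Measurability

/-! ### Restarting a Poisson process -/

namespace IsPoissonProcess

variable {Ω : Type*} [MeasurableSpace Ω] {P : Measure Ω} {r : ℝ≥0}
  {N : ℝ≥0 → Ω → ℕ}

theorem shift (hN : IsPoissonProcess r N P) (a : ℝ≥0) : IsPoissonProcess r (shift a N) P where
  measurable t := (hN.measurable _).sub (hN.measurable _)
  zero ω := by simp [Telegraph.shift]
  mono ω := shift_mono (hN.mono ω) a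
  rightCont ω t := by
    have h1 : ContinuousWithinAt (fun s => N (s + a) ω) (Ici t) t :=
      (hN.rightCont ω (t + a)).comp (f := fun s => s + a) (t := Ici (t + a))
        (by fun_prop) fun s hs => by
          simp only [mem_Ici] at hs ⊢
          gcongr
    have h2 : Continuous fun n : ℕ => n - N a ω := continuous_of_discreteTopology
    exact h2.continuousAt.comp_continuousWithinAt h1
  indepIncrements n t ht := by
    convert! hN.indepIncrements n (fun i => t i + a) (fun i j h => by
      simp only
      gcongr
      exact ht h) using 3 with i ω
    have h1 : N a ω ≤ N (t i.castSucc + a) ω := hN.mono ω le_add_self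
    simp only [Telegraph.shift]
    omega
  law_sub s t hst := by
    convert! hN.law_sub (s + a) (t + a) (by gcongr) using 1
    · funext ω
      have h1 : N a ω ≤ N (s + a) ω := hN.mono ω le_add_self
      simp only [Telegraph.shift]
      omega
    · rw [add_tsub_add_eq_tsub_right]

theorem real_eq (hN : IsPoissonProcess r N P) (t : ℝ≥0) (n : ℕ) :
    P.real {ω | N t ω = n} = Real.exp (-(r * t)) * (r * t) ^ n / n ! := by
  have h1 := (hN.law_sub 0 t zero_le).measure_eq (p := (· = n)) (measurableSet_singleton n)
  have h2 := poissonMeasure_real_singleton (r * t) n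
  simp only [hN.zero, tsub_zero] at h1
  rw [measureReal_def] at h2 ⊢
  rw [h1, ← NNReal.coe_mul]
  exact h2

/-- The process restarted at time `h` is independent of `N h`. -/
theorem indepFun_shift [IsProbabilityMeasure P] (hN : IsPoissonProcess r N P) (h : ℝ≥0) :
    IndepFun (N h) (fun ω s => Telegraph.shift h N s ω) P := by
  refine IndepFun.indepFun_process (hN.measurable h) (hN.shift h).measurable fun I => ?_
  -- The increments are taken between `0`, `h` and the times `h + σ j`, where `σ 0 = 0` and
  -- `σ 1, σ 2, …` enumerates `I` in increasing order, repeating the largest element.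
  let rk : ℝ≥0 → ℕ := fun i => (I.filter (· < i)).card
  let σ : ℕ → ℝ≥0 := fun j => (I.filter fun i => rk i < j).sup id
  have hσ : Monotone σ := fun j k hjk =>
    Finset.sup_mono fun i hi => by
      simp only [Finset.mem_filter] at hi ⊢
      exact ⟨hi.1, hi.2.trans_le hjk⟩
  have hσ0 : σ 0 = 0 := by simp [σ]
  have hσI (i : ℝ≥0) (hi : i ∈ I) : σ (rk i + 1) = i := by
    apply le_antisymm
    · refine Finset.sup_le fun j hj => ?_
      simp only [Finset.mem_filter] at hj
      by_contra! hlt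
      have : rk i < rk j := by
        refine Finset.card_lt_card ⟨fun k hk => ?_, fun hsub => ?_⟩
        · simp only [Finset.mem_filter] at hk ⊢
          exact ⟨hk.1, hk.2.trans hlt⟩
        · have : i ∈ I.filter (· < i) := hsub (by simpa [hi] using hlt)
          simp at this
      omega
    · exact Finset.le_sup (f := id) (by simp [hi])
  let τ : ℕ → ℝ≥0 := fun
    | 0 => 0
    | j + 1 => σ j + h
  have hτ : Monotone τ := monotone_nat_of_le_succ fun j => by
    cases j with
    | zero => exact zero_le
    | succ j => exact add_le_add_left (hσ j.le_succ) h
  have hind := hN.indepIncrements.nat hτ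
  have hmeas (i : ℕ) : Measurable fun ω => N (τ (i + 1)) ω - N (τ i) ω :=
    (hN.measurable _).sub (hN.measurable _)
  have h1 := hind.indepFun_finset {0} (Finset.Icc 1 (I.card + 1))
    (by simp) hmeas
  have h2 := h1.comp (measurable_pi_apply (⟨0, by simp⟩ : ({0} : Finset ℕ)))
    (show Measurable fun (f : Finset.Icc 1 (I.card + 1) → ℕ) (i : I) =>
      ∑ j : Finset.Icc 1 (I.card + 1), if (j : ℕ) ≤ rk i + 1 then f j else 0 by
      refine measurable_pi_lambda _ fun i => Finset.measurable_sum _ fun j _ => ?_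
      split_ifs
      · exact measurable_pi_apply _
      · exact measurable_const)
  convert h2 using 1
  · funext ω
    simp [τ, hσ0, hN.zero]
  · funext ω i
    simp only [Function.comp]
    have htel (k : ℕ) : ∑ j ∈ Finset.Icc 1 k, (N (τ (j + 1)) ω - N (τ j) ω) =
        N (τ (k + 1)) ω - N (τ 1) ω := by
      induction k with
      | zero => simp
      | succ k ih =>
        rw [Finset.sum_Icc_succ_top (by omega), ih]
        have a1 := hN.mono ω (hτ (show 1 ≤ k + 1 by omega))
        have a2 := hN.mono ω (hτ (show k + 1 ≤ k + 1 + 1 by omega))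
        simp only at a1 a2
        omega
    rw [Finset.sum_coe_sort (Finset.Icc 1 (I.card + 1))
      (fun j => if j ≤ rk i + 1 then N (τ (j + 1)) ω - N (τ j) ω else 0), ← Finset.sum_filter]
    have hrk : rk i + 1 ≤ I.card + 1 := Nat.succ_le_succ (Finset.card_filter_le _ _)
    have : (Finset.Icc 1 (I.card + 1)).filter (· ≤ rk i + 1) = Finset.Icc 1 (rk i + 1) := by
      ext j
      simp only [Finset.mem_filter, Finset.mem_Icc]
      omega
    rw [this, htel]
    simp only [τ, hσ0, hσI i i.2, zero_add, Telegraph.shift]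

theorem real_inter_stayBelow_shift [IsProbabilityMeasure P] (hN : IsPoissonProcess r N P)
    (h t : ℝ≥0) (j n : ℕ) (v b : ℝ) :
    P.real ({ω | N h ω = j} ∩ stayBelow v (Telegraph.shift h N) n t b) =
      P.real {ω | N h ω = j} * P.real (stayBelow v (Telegraph.shift h N) n t b) := by
  have := (IndepFun_iff _ _ _).1 (hN.indepFun_shift h) {ω | N h ω = j}
    (stayBelow v (Telegraph.shift h N) n t b)
    ⟨{j}, measurableSet_singleton j, rfl⟩
    (measurableSet_comap_stayBelow (hN.shift h).mono (hN.shift h).rightCont v n t b)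
  simp only [measureReal_def, this, ENNReal.toReal_mul]

end IsPoissonProcess

/-! ### The first step of the motion -/

section Step

variable {Ω : Type*} {N : ℝ≥0 → Ω → ℕ}

theorem inter_stayBelow_of_eq_zero (hN : ∀ ω, Monotone fun t => N t ω) {v b : ℝ} (n : ℕ)
    (h t : ℝ≥0) (hb : 0 ≤ b) (hvb : v * h ≤ b) :
    {ω | N h ω = 0} ∩ stayBelow v N n (h + t) b =
      {ω | N h ω = 0} ∩ stayBelow v (shift h N) n t (b - v * h) := by
  ext ω
  simp only [stayBelow, mem_inter_iff, mem_ofPred_eq]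
  refine and_congr_right fun h0 => ?_
  rw [runningMax_add_le_iff (hN ω), position_eq_mul_of_eq_zero (hN ω) le_rfl h0]
  have h1 : runningMax (fun _ => v) N h ω ≤ b := by
    refine (runningMax_le_iff (hN ω) h b).2 fun s hs => ?_
    rw [position_eq_mul_of_eq_zero (hN ω) hs h0]
    have hs' : (s : ℝ) ≤ h := hs
    rcases le_total v 0 with hv | hv
    · exact (mul_nonpos_of_nonpos_of_nonneg hv s.coe_nonneg).trans hb
    · exact (mul_le_mul_of_nonneg_left hs' hv).trans hvb
  simp [h1, h0, shift, add_comm t h]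

theorem inter_stayBelow_of_eq_one_subset (hN : ∀ ω, Monotone fun t => N t ω) {v b : ℝ}
    (hv : |v| = 1) (n : ℕ) (h t : ℝ≥0) :
    {ω | N h ω = 1} ∩ stayBelow v N (n + 1) (h + t) b ⊆
      {ω | N h ω = 1} ∩ stayBelow (-v) (shift h N) n t (b + h) := by
  rintro ω ⟨h1, h2, h3⟩
  have h1' : N h ω = 1 := h1
  refine ⟨h1, ?_, ?_⟩
  · simp only [shift, add_comm t h, h2, h1', Nat.add_sub_cancel]
  · have h4 := ((runningMax_add_le_iff (hN ω) v h t b).1 h3).2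
    have h5 := abs_le.1 (abs_position_le (V := fun _ => v) (N := N) (ω := ω) h)
    simp only [h1', pow_one, mul_neg, mul_one] at h4
    simp only [hv, one_mul] at h5
    linarith [h5.1]

theorem subset_inter_stayBelow_of_eq_one (hN : ∀ ω, Monotone fun t => N t ω) {v b : ℝ}
    (hv : |v| = 1) (n : ℕ) (h t : ℝ≥0) :
    {ω | N h ω = 1} ∩ stayBelow (-v) (shift h N) n t (b - h) ⊆
      {ω | N h ω = 1} ∩ stayBelow v N (n + 1) (h + t) b := by
  rintro ω ⟨h1, h2, h3⟩
  have h1' : N h ω = 1 := h1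
  have h5 := abs_le.1 (abs_position_le (V := fun _ => v) (N := N) (ω := ω) h)
  simp only [hv, one_mul] at h5
  have h6 := runningMax_nonneg (V := fun _ => -v) (shift_mono (hN ω) h) t
  have h7 := runningMax_le_mul (V := fun _ => v) (hN ω) h
  simp only [hv, one_mul] at h7
  refine ⟨h1, ?_, (runningMax_add_le_iff (hN ω) v h t b).2 ⟨by linarith, ?_⟩⟩
  · have := hN ω (le_self_add : h ≤ h + t)
    simp only [shift, add_comm t h] at h2 this
    omega
  · simp only [h1', pow_one, mul_neg, mul_one]
    linarith [h5.2]

variable [MeasurableSpace Ω] {P : Measure Ω} {r : ℝ≥0}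

/-- The probability that the counter reads `n` at time `t` and the motion with initial velocity
`v` has stayed below `b`, in units of `exp (-r t) r ^ n`, so that it becomes the volume of the set
of the admissible jump times. -/
noncomputable def stayVolume (P : Measure Ω) (r : ℝ≥0) (v : ℝ) (N : ℝ≥0 → Ω → ℕ) (n : ℕ)
    (t : ℝ≥0) (b : ℝ) : ℝ :=
  Real.exp (r * t) / r ^ n * P.real (stayBelow v N n t b)

theorem stayVolume_nonneg (v : ℝ) (n : ℕ) (t : ℝ≥0) (b : ℝ) : 0 ≤ stayVolume P r v N n t b := by
  unfold stayVolume
  positivity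

theorem stayVolume_le [IsProbabilityMeasure P] (v : ℝ) (n : ℕ) (t : ℝ≥0) (b : ℝ) :
    stayVolume P r v N n t b ≤ Real.exp (r * t) / r ^ n :=
  mul_le_of_le_one_right (by positivity) measureReal_le_one

theorem stayBelow_of_le (hN : IsPoissonProcess r N P) {v : ℝ} (hv : |v| = 1) (n : ℕ)
    {t : ℝ≥0} {b : ℝ} (hb : t ≤ b) : stayBelow v N n t b = {ω | N t ω = n} := by
  ext ω
  refine and_iff_left ((runningMax_le_mul (hN.mono ω) t).trans ?_)
  simpa [hv] using hb

/-- For a level that cannot be exceeded this is the volume `tⁿ / n!` of all jump times. -/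
theorem stayVolume_of_le (hN : IsPoissonProcess r N P) (hr : 0 < r) {v : ℝ} (hv : |v| = 1)
    (n : ℕ) {t : ℝ≥0} {b : ℝ} (hb : t ≤ b) : stayVolume P r v N n t b = t ^ n / n ! := by
  have hr' : (r : ℝ) ≠ 0 := by exact_mod_cast hr.ne'
  rw [stayVolume, stayBelow_of_le hN hv n hb, hN.real_eq, Real.exp_neg, mul_pow]
  have := Real.exp_ne_zero (r * t)
  field_simp

/-- A path starting upwards leaves the level `0` before the first jump. -/
theorem stayVolume_one_zero [IsProbabilityMeasure P] (hN : IsPoissonProcess r N P)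
    (n : ℕ) (t : ℝ≥0) :
    stayVolume P r 1 N (n + 1) t 0 = 0 := by
  have hle (h : ℝ≥0) (h0 : 0 < h) : P.real (stayBelow 1 N (n + 1) t 0) ≤
      1 - Real.exp (-(r * h)) := by
    have h1 : stayBelow 1 N (n + 1) t 0 ⊆ {ω | N h ω = 0}ᶜ := by
      rintro ω ⟨h2, h3⟩ (h4 : N h ω = 0)
      have h5 : h < t := by
        by_contra! hlt
        have := hN.mono ω hlt
        simp only at this
        omega
      have h6 := (runningMax_le_iff (hN.mono ω) t 0).1 h3 h h5.le
      rw [position_eq_mul_of_eq_zero (hN.mono ω) le_rfl h4, one_mul] at h6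
      exact absurd h6 (not_le.2 (by exact_mod_cast h0))
    refine (measureReal_mono h1).trans ?_
    have hm : MeasurableSet {ω | N h ω = 0} := hN.measurable h (measurableSet_singleton 0)
    rw [measureReal_compl hm, probReal_univ,
      hN.real_eq]
    simp
  have h2 : P.real (stayBelow 1 N (n + 1) t 0) ≤ 0 := by
    have hlim : Filter.Tendsto (fun h : ℝ≥0 => 1 - Real.exp (-(r * h))) (nhdsWithin 0 (Ioi 0))
        (nhds 0) := by
      have : Continuous fun h : ℝ≥0 => 1 - Real.exp (-(r * (h : ℝ))) := by fun_prop
      simpa using this.continuousWithinAt.tendsto (x := 0) (s := Ioi 0)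
    exact ge_of_tendsto hlim (Filter.eventually_of_mem self_mem_nhdsWithin hle)
  rw [stayVolume, le_antisymm h2 measureReal_nonneg, mul_zero]

theorem stayVolume_neg_one_zero (hN : IsPoissonProcess r N P) {t : ℝ≥0} {b : ℝ}
    (hb : 0 ≤ b) : stayVolume P r (-1) N 0 t b = 1 := by
  have h1 : stayBelow (-1) N 0 t b = {ω | N t ω = 0} := by
    ext ω
    refine and_iff_left_of_imp fun h0 => (runningMax_le_iff (hN.mono ω) t b).2 fun s hs => ?_
    rw [position_eq_mul_of_eq_zero (hN.mono ω) hs h0]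
    linarith [s.coe_nonneg]
  rw [stayVolume, h1, hN.real_eq, Real.exp_neg]
  have := Real.exp_ne_zero (r * t)
  simp [this]

theorem stayVolume_zero_of_lt (hN : IsPoissonProcess r N P) {t : ℝ≥0} {b : ℝ} (hb : b < t) :
    stayVolume P r 1 N 0 t b = 0 := by
  have h1 : stayBelow 1 N 0 t b = ∅ := by
    refine eq_empty_of_forall_notMem fun ω ⟨h2, h3⟩ => ?_
    have h6 := (runningMax_le_iff (hN.mono ω) t b).1 h3 t le_rfl
    rw [position_eq_mul_of_eq_zero (hN.mono ω) le_rfl h2, one_mul] at h6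
    exact absurd h6 (not_le.2 hb)
  simp [stayVolume, h1]

/-- Splitting according to the number of jumps in `[0, h]`: no jump in the first term, one jump in
the second, where the position at time `h` is at most `h`. -/
theorem le_stayVolume_add [IsProbabilityMeasure P] (hN : IsPoissonProcess r N P)
    (hr : 0 < r) {v : ℝ} (hv : |v| = 1) (n : ℕ) (h t : ℝ≥0) {b : ℝ} (hb : 0 ≤ b) (hvb : v * h ≤ b) :
    stayVolume P r v (shift h N) (n + 1) t (b - v * h) +
        h * stayVolume P r (-v) (shift h N) n t (b - h) ≤
      stayVolume P r v N (n + 1) (h + t) b := by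
  have hr' : (r : ℝ) ≠ 0 := by exact_mod_cast hr.ne'
  have hm (j : ℕ) : MeasurableSet {ω | N h ω = j} := hN.measurable h (measurableSet_singleton j)
  have hmS (v : ℝ) (n : ℕ) (b : ℝ) : MeasurableSet (stayBelow v (shift h N) n t b) :=
    measurableSet_stayBelow (hN.shift h).measurable (hN.shift h).mono (hN.shift h).rightCont v n t b
  have e0 := hN.real_inter_stayBelow_shift h t 0 (n + 1) v (b - v * h)
  have e1 := hN.real_inter_stayBelow_shift h t 1 n (-v) (b - h)
  rw [hN.real_eq] at e0 e1
  have hdisj : Disjoint ({ω | N h ω = 0} ∩ stayBelow v (shift h N) (n + 1) t (b - v * h))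
      ({ω | N h ω = 1} ∩ stayBelow (-v) (shift h N) n t (b - h)) := by
    refine Set.disjoint_left.2 ?_
    rintro ω ⟨h0, -⟩ ⟨h1, -⟩
    simp_all
  have hsub : ({ω | N h ω = 0} ∩ stayBelow v (shift h N) (n + 1) t (b - v * h)) ∪
      ({ω | N h ω = 1} ∩ stayBelow (-v) (shift h N) n t (b - h)) ⊆
      stayBelow v N (n + 1) (h + t) b := by
    refine union_subset ?_ ?_
    · rw [← inter_stayBelow_of_eq_zero hN.mono _ h t hb hvb]
      exact inter_subset_right
    · exact (subset_inter_stayBelow_of_eq_one hN.mono hv n h t).trans inter_subset_right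
  have key := measureReal_mono (μ := P) hsub
  rw [measureReal_union hdisj ((hm 1).inter (hmS _ _ _)), e0, e1] at key
  have hw : 0 ≤ Real.exp (r * (h + t)) / (r : ℝ) ^ (n + 1) := by positivity
  calc _ = Real.exp (r * (h + t)) / (r : ℝ) ^ (n + 1) * _ := ?_
    _ ≤ _ := mul_le_mul_of_nonneg_left key hw
    _ = _ := by simp [stayVolume]
  simp only [stayVolume]
  rw [mul_add, mul_add (r : ℝ), Real.exp_add, Real.exp_neg]
  have := Real.exp_ne_zero (r * h)
  simp only [pow_zero, pow_one, Nat.factorial_zero, Nat.factorial_one]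
  field_simp
  simp
  ring

/-- The companion upper bound: one jump in `[0, h]` leaves the position at time `h` at least `-h`,
and two or more jumps have probability at most `(r h) ^ 2`. -/
theorem stayVolume_add_le [IsProbabilityMeasure P] (hN : IsPoissonProcess r N P)
    (hr : 0 < r) {v : ℝ} (hv : |v| = 1) (n : ℕ) (h t : ℝ≥0) {b : ℝ} (hb : 0 ≤ b) (hvb : v * h ≤ b) :
    stayVolume P r v N (n + 1) (h + t) b ≤
      stayVolume P r v (shift h N) (n + 1) t (b - v * h) +
        h * stayVolume P r (-v) (shift h N) n t (b + h) +
        Real.exp (r * (h + t)) * r ^ 2 / r ^ (n + 1) * h ^ 2 := by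
  have hr' : (r : ℝ) ≠ 0 := by exact_mod_cast hr.ne'
  have hm (j : ℕ) : MeasurableSet {ω | N h ω = j} := hN.measurable h (measurableSet_singleton j)
  have e0 := hN.real_inter_stayBelow_shift h t 0 (n + 1) v (b - v * h)
  have e1 := hN.real_inter_stayBelow_shift h t 1 n (-v) (b + h)
  rw [hN.real_eq] at e0 e1
  have hsub : stayBelow v N (n + 1) (h + t) b ⊆
      (({ω | N h ω = 0} ∩ stayBelow v (shift h N) (n + 1) t (b - v * h)) ∪
      ({ω | N h ω = 1} ∩ stayBelow (-v) (shift h N) n t (b + h))) ∪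
      ({ω | N h ω = 0} ∪ {ω | N h ω = 1})ᶜ := by
    intro ω hω
    by_cases h0 : N h ω = 0
    · refine Or.inl (Or.inl ?_)
      rw [← inter_stayBelow_of_eq_zero hN.mono _ h t hb hvb]
      exact ⟨h0, hω⟩
    by_cases h1 : N h ω = 1
    · exact Or.inl (Or.inr (inter_stayBelow_of_eq_one_subset hN.mono hv n h t ⟨h1, hω⟩))
    · exact Or.inr fun hor => hor.elim h0 h1
  have hrest : P.real ({ω | N h ω = 0} ∪ {ω | N h ω = 1})ᶜ ≤ (r * h) ^ 2 := by
    rw [measureReal_compl ((hm 0).union (hm 1)), probReal_univ, measureReal_union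
      (Set.disjoint_left.2 fun ω h0 h1 => by simp_all) (hm 1), hN.real_eq, hN.real_eq]
    simp only [pow_zero, pow_one, Nat.factorial_zero, Nat.factorial_one, Nat.cast_one, div_one]
    have := Real.add_one_le_exp (-((r : ℝ) * h))
    have hx : 0 ≤ (r : ℝ) * h := by positivity
    nlinarith
  have key := (measureReal_mono (μ := P) hsub).trans
    ((measureReal_union_le _ _).trans (add_le_add (measureReal_union_le _ _) hrest))
  rw [e0, e1] at key
  have hw : 0 ≤ Real.exp (r * (h + t)) / (r : ℝ) ^ (n + 1) := by positivity
  calc _ = Real.exp (r * (h + t)) / (r : ℝ) ^ (n + 1) * _ := by simp [stayVolume]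
    _ ≤ _ := mul_le_mul_of_nonneg_left key hw
    _ = _ := ?_
  simp only [stayVolume]
  rw [mul_add, mul_add, mul_add (r : ℝ), Real.exp_add, Real.exp_neg]
  have := Real.exp_ne_zero (r * h)
  simp only [pow_zero, pow_one, Nat.factorial_zero, Nat.factorial_one]
  field_simp
  simp
  ring

end Step

/-! ### The explicit volumes -/

/-- The integral `∫₀ᵇ (t² - x²)ᵏ dx`, defined by the recursion that integration by parts gives. -/
noncomputable def powInt : ℕ → ℝ → ℝ → ℝ
  | 0, _, b => b
  | k + 1, t, b =>
    (2 * (k + 1) * t ^ 2 * powInt k t b + b * (t ^ 2 - b ^ 2) ^ (k + 1)) / (2 * k + 3)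

/-- The recursion in the form in which the derivative computations use it. -/
theorem powInt_succ (k : ℕ) (t b : ℝ) :
    (2 * k + 3) * powInt (k + 1) t b =
      2 * (k + 1) * t ^ 2 * powInt k t b + b * (t ^ 2 - b ^ 2) ^ (k + 1) := by
  have : (2 * (k : ℝ) + 3) ≠ 0 := by positivity
  rw [powInt]
  field_simp

theorem powInt_zero_right (k : ℕ) (t : ℝ) : powInt k t 0 = 0 := by
  induction k with
  | zero => rfl
  | succ k ih => simp [powInt, ih]

theorem continuous_powInt (k : ℕ) : Continuous fun p : ℝ × ℝ => powInt k p.1 p.2 := by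
  induction k with
  | zero => exact continuous_snd
  | succ k ih =>
    simp only [powInt]
    fun_prop

theorem powInt_mul (c : ℝ) (k : ℕ) (t b : ℝ) :
    powInt k (c * t) (c * b) = c ^ (2 * k + 1) * powInt k t b := by
  induction k with
  | zero => simp [powInt]
  | succ k ih =>
    simp only [powInt, ih, mul_pow, ← mul_sub]
    ring

/-- Total derivative along a line in the `(t, b)`-plane. The value `powInt (0 - 1)` at `k = 0` is
harmless, as its coefficient vanishes. -/
theorem hasDerivAt_powInt (p q a b : ℝ) (k : ℕ) (s : ℝ) :
    HasDerivAt (fun s => powInt k (a + p * s) (b + q * s))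
      (p * (2 * k * (a + p * s) * powInt (k - 1) (a + p * s) (b + q * s)) +
        q * ((a + p * s) ^ 2 - (b + q * s) ^ 2) ^ k) s := by
  have hT : HasDerivAt (fun s => a + p * s) p s := by
    simpa using ((hasDerivAt_id s).const_mul p).const_add a
  have hB : HasDerivAt (fun s => b + q * s) q s := by
    simpa using ((hasDerivAt_id s).const_mul q).const_add b
  induction k with
  | zero => simpa [powInt] using hB
  | succ k ih =>
    have h1 := ((((hT.pow 2).const_mul (2 * ((k : ℝ) + 1))).mul ih).add
      (hB.mul (((hT.pow 2).sub (hB.pow 2)).pow (k + 1)))).div_const (2 * k + 3)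
    refine (h1.congr_deriv ?_).congr_of_eventuallyEq (Filter.Eventually.of_forall fun s => ?_)
    · simp only [Pi.pow_apply, Pi.sub_apply, Nat.add_sub_cancel]
      generalize a + p * s = T
      generalize b + q * s = B
      have h3 : (2 * (k : ℝ) + 3) ≠ 0 := by positivity
      rw [div_eq_iff h3]
      cases k with
      | zero => simp [powInt]; ring
      | succ k =>
        have := powInt_succ k T B
        simp only [Nat.add_sub_cancel]
        push_cast at this ⊢
        linear_combination (-(2 * (k : ℝ) + 4) * p * T) * this
    · simp [powInt]

/-- The beta integral `∫₀ᵗ (t² - x²)ᵏ dx = 4ᵏ k!² / (2k+1)! * t ^ (2k+1)`. -/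
theorem powInt_self (k : ℕ) (t : ℝ) :
    powInt k t t * (2 * k + 1)! = 4 ^ k * (k ! : ℝ) ^ 2 * t ^ (2 * k + 1) := by
  induction k with
  | zero => simp [powInt]
  | succ k ih =>
    have h1 := powInt_succ k t t
    rw [sub_self, zero_pow (by omega), mul_zero, add_zero] at h1
    rw [show 2 * (k + 1) + 1 = 2 * k + 1 + 1 + 1 by ring, Nat.factorial_succ, Nat.factorial_succ,
      Nat.factorial_succ k]
    push_cast
    linear_combination (2 * (k : ℝ) + 2) * ((2 * k + 1)! : ℝ) * h1 +
      (2 * (k : ℝ) + 2) ^ 2 * t ^ 2 * ih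

/-- The volume of the set of jump times `0 < s₁ < ⋯ < sₙ < t` for which the unit-speed motion
starting upwards stays below `b`, for `0 ≤ b < t`. -/
noncomputable def upVolume (n : ℕ) (t b : ℝ) : ℝ :=
  match n with
  | 0 => 0
  | n + 1 =>
    if Even n then powInt (n / 2) t b / (4 ^ (n / 2) * ((n / 2) ! : ℝ) ^ 2)
    else t * powInt (n / 2) t b / ((n + 1) * (4 ^ (n / 2) * ((n / 2) ! : ℝ) ^ 2))

/-- The volume of the set of jump times `0 < s₁ < ⋯ < sₙ < t` for which the unit-speed motion
starting downwards stays below `b`, for `0 ≤ b ≤ t`. -/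
noncomputable def downVolume (n : ℕ) (t b : ℝ) : ℝ :=
  if Even n then
    ((t ^ 2 - b ^ 2) ^ (n / 2) + n * t * powInt (n / 2 - 1) t b) /
      (4 ^ (n / 2) * ((n / 2) ! : ℝ) ^ 2)
  else
    ((n + 1) * powInt (n / 2) t b + (t - b) * (t ^ 2 - b ^ 2) ^ (n / 2)) /
      ((n + 1) * (4 ^ (n / 2) * ((n / 2) ! : ℝ) ^ 2))

theorem upVolume_odd (k : ℕ) (t b : ℝ) :
    upVolume (2 * k + 1) t b = powInt k t b / (4 ^ k * (k ! : ℝ) ^ 2) := by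
  simp [upVolume]

theorem upVolume_even (k : ℕ) (t b : ℝ) :
    upVolume (2 * k + 2) t b =
      t * powInt k t b / ((2 * k + 2) * (4 ^ k * (k ! : ℝ) ^ 2)) := by
  have : (2 * k + 1) / 2 = k := by omega
  simp [upVolume, this, add_assoc, one_add_one_eq_two]

theorem downVolume_even (k : ℕ) (t b : ℝ) :
    downVolume (2 * k) t b =
      ((t ^ 2 - b ^ 2) ^ k + 2 * k * t * powInt (k - 1) t b) / (4 ^ k * (k ! : ℝ) ^ 2) := by
  simp [downVolume]

theorem downVolume_odd (k : ℕ) (t b : ℝ) :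
    downVolume (2 * k + 1) t b =
      ((2 * k + 2) * powInt k t b + (t - b) * (t ^ 2 - b ^ 2) ^ k) /
        ((2 * k + 2) * (4 ^ k * (k ! : ℝ) ^ 2)) := by
  have : (2 * k + 1) / 2 = k := by omega
  simp [downVolume, this, add_assoc, one_add_one_eq_two]

theorem continuous_upVolume (n : ℕ) : Continuous fun p : ℝ × ℝ => upVolume n p.1 p.2 := by
  have h := continuous_powInt
  cases n with
  | zero => exact continuous_const
  | succ n =>
    simp only [upVolume]
    split_ifs
    · exact (h _).div_const _
    · exact (continuous_fst.mul (h _)).div_const _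

theorem continuous_downVolume (n : ℕ) : Continuous fun p : ℝ × ℝ => downVolume n p.1 p.2 := by
  have h := continuous_powInt
  simp only [downVolume]
  split_ifs
  · have := h (n / 2 - 1)
    fun_prop
  · have := h (n / 2)
    fun_prop

theorem upVolume_zero_right (n : ℕ) (t : ℝ) : upVolume n t 0 = 0 := by
  cases n with
  | zero => rfl
  | succ n => simp [upVolume, powInt_zero_right]

theorem downVolume_self (n : ℕ) (t : ℝ) : downVolume n t t = t ^ n / n ! := by
  obtain ⟨k, rfl | rfl⟩ := n.even_or_odd'
  · rw [downVolume_even]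
    cases k with
    | zero => simp
    | succ k =>
      have h1 := powInt_self k t
      rw [sub_self, zero_pow (by omega), Nat.add_sub_cancel, div_eq_div_iff (by positivity)
        (by positivity), show 2 * (k + 1) = 2 * k + 1 + 1 by ring, Nat.factorial_succ (2 * k + 1),
        Nat.factorial_succ k]
      push_cast
      linear_combination (2 * (k : ℝ) + 2) ^ 2 * t * h1
  · have h1 := powInt_self k t
    rw [downVolume_odd, sub_self, zero_mul, add_zero, div_eq_div_iff (by positivity)
      (by positivity)]
    linear_combination (2 * (k : ℝ) + 2) * h1

/-- The transport equation `(∂ₜ + ∂_b) up = down`. -/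
theorem hasDerivAt_upVolume (n : ℕ) (a b s : ℝ) :
    HasDerivAt (fun s => upVolume (n + 1) (a + s) (b + s)) (downVolume n (a + s) (b + s)) s := by
  have hI (k : ℕ) := hasDerivAt_powInt 1 1 a b k s
  simp only [one_mul] at hI
  have hT : HasDerivAt (fun s => a + s) 1 s := (hasDerivAt_id s).const_add a
  obtain ⟨k, rfl | rfl⟩ := n.even_or_odd'
  · simp only [upVolume_odd, downVolume_even]
    refine ((hI k).div_const _).congr_deriv ?_
    ring
  · simp only [upVolume_even, downVolume_odd]
    refine ((hT.mul (hI k)).div_const _).congr_deriv ?_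
    congr 1
    generalize a + s = T
    generalize b + s = B
    cases k with
    | zero => simp [powInt]; ring
    | succ k =>
      have := powInt_succ k T B
      simp only [Nat.add_sub_cancel]
      push_cast
      linear_combination (-1) * this

/-- The transport equation `(∂ₜ - ∂_b) down = up`. -/
theorem hasDerivAt_downVolume (n : ℕ) (a b s : ℝ) :
    HasDerivAt (fun s => downVolume (n + 1) (a + s) (b - s)) (upVolume n (a + s) (b - s)) s := by
  have hI (k : ℕ) := hasDerivAt_powInt 1 (-1) a b k s
  simp only [one_mul, neg_mul, ← sub_eq_add_neg] at hI
  have hT : HasDerivAt (fun s => a + s) 1 s := (hasDerivAt_id s).const_add a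
  have hB : HasDerivAt (fun s => b - s) (-1) s := (hasDerivAt_id s).const_sub b
  have hX (k : ℕ) := ((hT.pow 2).sub (hB.pow 2)).pow k
  simp only [Pi.pow_apply, Pi.sub_apply] at hX
  obtain ⟨k, rfl | rfl⟩ := n.even_or_odd'
  · simp only [downVolume_odd]
    have := ((((hI k).const_mul (2 * (k : ℝ) + 2)).add ((hT.sub hB).mul (hX k))).div_const
      ((2 * k + 2) * (4 ^ k * (k ! : ℝ) ^ 2)))
    refine (this.congr_deriv ?_).congr_of_eventuallyEq (Filter.Eventually.of_forall fun s => ?_)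
    · cases k with
      | zero => simp [upVolume]; ring
      | succ k =>
        rw [show 2 * (k + 1) = 2 * k + 2 by ring, upVolume_even, div_eq_div_iff (by positivity)
          (by positivity), Nat.factorial_succ k]
        simp only [Nat.add_sub_cancel, Pi.sub_apply, Pi.pow_apply]
        push_cast
        ring
    · simp
  · simp only [show 2 * k + 1 + 1 = 2 * (k + 1) by ring, downVolume_even, upVolume_odd]
    have := ((hX (k + 1)).add (((hT.mul (hI k)).const_mul (2 * ((k : ℝ) + 1))))).div_const
      (4 ^ (k + 1) * ((k + 1) ! : ℝ) ^ 2)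
    refine (this.congr_deriv ?_).congr_of_eventuallyEq (Filter.Eventually.of_forall fun s => ?_)
    · rw [div_eq_div_iff (by positivity) (by positivity), Nat.factorial_succ k]
      generalize a + s = T
      generalize b - s = B
      cases k with
      | zero => simp [powInt]; ring
      | succ k =>
        have h3 := powInt_succ k T B
        simp only [Nat.add_sub_cancel]
        push_cast
        linear_combination (-8 * ((k : ℝ) + 2) * ((k + 1)! : ℝ) ^ 2 * 4 ^ k) * h3
    · simp
      ring

/-! ### Integration along characteristics -/

open Filter Topology in
theorem hasDerivWithinAt_Ici_of_squeeze {f lo hi : ℝ → ℝ} {s D : ℝ}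
    (hlo : Tendsto lo (𝓝[>] 0) (𝓝 D)) (hhi : Tendsto hi (𝓝[>] 0) (𝓝 D))
    (h1 : ∀ᶠ h in 𝓝[>] (0 : ℝ), h * lo h ≤ f (s + h) - f s)
    (h2 : ∀ᶠ h in 𝓝[>] (0 : ℝ), f (s + h) - f s ≤ h * hi h) :
    HasDerivWithinAt f D (Ici s) s := by
  rw [← hasDerivWithinAt_Ioi_iff_Ici, hasDerivWithinAt_iff_tendsto_slope' self_notMem_Ioi]
  have h3 : Tendsto (fun h => slope f s (s + h)) (𝓝[>] 0) (𝓝 D) := by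
    refine tendsto_of_tendsto_of_tendsto_of_le_of_le' hlo hhi ?_ ?_
    · filter_upwards [h1, self_mem_nhdsWithin] with h h1 (h0 : 0 < h)
      rw [slope_def_field, add_sub_cancel_left, le_div_iff₀ h0]
      linarith
    · filter_upwards [h2, self_mem_nhdsWithin] with h h2 (h0 : 0 < h)
      rw [slope_def_field, add_sub_cancel_left, div_le_iff₀ h0]
      linarith
  have h4 : Tendsto (fun x => x - s) (𝓝[>] s) (𝓝[>] 0) := by
    refine tendsto_nhdsWithin_iff.2 ⟨?_, ?_⟩
    · have : Continuous fun x : ℝ => x - s := by fun_prop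
      simpa using this.continuousWithinAt.tendsto (x := s) (s := Ioi s)
    · filter_upwards [self_mem_nhdsWithin] with x (hx : s < x)
      exact sub_pos.2 hx
  simpa [Function.comp_def] using h3.comp h4

open Filter Topology in
/-- Two functions with the same right derivative in the open interval and the same initial value
agree at the end of the interval. -/
theorem eq_of_rightDeriv_eq {f g g' : ℝ → ℝ} {L K : ℝ} (hL : 0 ≤ L)
    (hf : ∀ s h, 0 ≤ s → 0 ≤ h → s + h ≤ L → |f (s + h) - f s| ≤ K * h)
    (hf' : ∀ s ∈ Ioo 0 L, HasDerivWithinAt f (g' s) (Ici s) s)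
    (hg : ∀ s, HasDerivAt g (g' s) s) (h0 : f 0 = g 0) : f L = g L := by
  have hfc : ContinuousOn f (Icc 0 L) := by
    refine LipschitzOnWith.continuousOn (K := K.toNNReal) (LipschitzOnWith.of_dist_le_mul ?_)
    have key (x) (hx : x ∈ Icc 0 L) (y) (hy : y ∈ Icc 0 L) (hxy : x ≤ y) :
        dist (f x) (f y) ≤ K.toNNReal * dist x y := by
      have := hf x (y - x) hx.1 (sub_nonneg.2 hxy) (by simpa using hy.2)
      rw [dist_comm, dist_comm x, Real.dist_eq, Real.dist_eq, abs_of_nonneg (sub_nonneg.2 hxy)]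
      rw [add_sub_cancel] at this
      exact this.trans (mul_le_mul_of_nonneg_right (Real.le_coe_toNNReal K) (sub_nonneg.2 hxy))
    intro x hx y hy
    rcases le_total x y with h | h
    · exact key x hx y hy h
    · rw [dist_comm, dist_comm x]
      exact key y hy x hx h
  have hgc : Continuous g := continuous_iff_continuousAt.2 fun s => (hg s).continuousAt
  have hdc : ContinuousOn (fun s => f s - g s) (Icc 0 L) := hfc.sub hgc.continuousOn
  rcases hL.eq_or_lt with rfl | hL
  · exact h0
  have hconst : ∀ ε ∈ Ioo 0 L, f L - g L = f ε - g ε := by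
    intro ε hε
    refine constant_of_has_deriv_right_zero (hdc.mono (Icc_subset_Icc_left hε.1.le))
      (fun x hx => ?_) L (right_mem_Icc.2 hε.2.le)
    exact ((hf' x ⟨hε.1.trans_le hx.1, hx.2⟩).sub (hg x).hasDerivWithinAt).congr_deriv (sub_self _)
  have h1 : Tendsto (fun s => f s - g s) (𝓝[>] 0) (𝓝 (f 0 - g 0)) :=
    (hdc 0 (left_mem_Icc.2 hL.le)).mono_left (nhdsWithin_le_of_mem (by
      filter_upwards [Ioo_mem_nhdsGT hL] with x hx using ⟨hx.1.le, hx.2.le⟩))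
  have h2 : Tendsto (fun s => f s - g s) (𝓝[>] 0) (𝓝 (f L - g L)) := by
    refine tendsto_const_nhds.congr' ?_
    filter_upwards [Ioo_mem_nhdsGT hL] with x hx using hconst x hx
  have := tendsto_nhds_unique h2 h1
  rw [h0, sub_self] at this
  linarith

open Filter Topology in
/-- If the volumes with `n` jumps and initial velocity `-v` are given by `w`, then those with
`n + 1` jumps and initial velocity `v` solve a transport equation with right-hand side `w`,
and therefore agree with any function `u` that solves it with the same initial value. -/
theorem stayVolume_eq_along_characteristic {Ω : Type*} [MeasurableSpace Ω] {P : Measure Ω}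
    [IsProbabilityMeasure P] {r : ℝ≥0} (hr : 0 < r) {v : ℝ} (hv : |v| = 1) {n : ℕ}
    {w u : ℝ → ℝ → ℝ} (hwc : Continuous fun p : ℝ × ℝ => w p.1 p.2)
    (hw : ∀ N : ℝ≥0 → Ω → ℕ, IsPoissonProcess r N P → ∀ (t : ℝ≥0) (b : ℝ), 0 ≤ b → b < t →
      stayVolume P r (-v) N n t b = w t b)
    {t₀ L : ℝ≥0} {b₀ : ℝ} (hb : ∀ s ∈ Icc 0 (L : ℝ), 0 ≤ b₀ + v * s)
    (hbt : ∀ s ∈ Ioo 0 (L : ℝ), 0 < b₀ + v * s ∧ b₀ + v * s < t₀ + s)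
    (hu : ∀ s : ℝ, HasDerivAt (fun s => u (t₀ + s) (b₀ + v * s)) (w (t₀ + s) (b₀ + v * s)) s)
    (h0 : ∀ N : ℝ≥0 → Ω → ℕ, IsPoissonProcess r N P →
      stayVolume P r v N (n + 1) t₀ b₀ = u t₀ b₀)
    {N : ℝ≥0 → Ω → ℕ} (hN : IsPoissonProcess r N P) :
    stayVolume P r v N (n + 1) (t₀ + L) (b₀ + v * L) = u (t₀ + L) (b₀ + v * L) := by
  let f : ℝ → ℝ := fun s =>
    stayVolume P r v (shift (L - s).toNNReal N) (n + 1) (t₀ + s).toNNReal (b₀ + v * s)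
  let C : ℝ := Real.exp (r * (t₀ + L)) * r ^ 2 / r ^ (n + 1)
  -- The two estimates for one step of the motion, from time `s` to time `s + h` on the
  -- characteristic.
  have step (s h : ℝ) (hs : 0 ≤ s) (hh : 0 ≤ h) (hsh : s + h ≤ L) :
      h * stayVolume P r (-v) (shift (L - s).toNNReal N) n (t₀ + s).toNNReal
          (b₀ + v * (s + h) - h) ≤ f (s + h) - f s ∧
      f (s + h) - f s ≤ h * stayVolume P r (-v) (shift (L - s).toNNReal N) n
          (t₀ + s).toNNReal (b₀ + v * (s + h) + h) + C * h ^ 2 := by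
    have hN' := hN.shift (L - (s + h)).toNNReal
    have e1 : shift h.toNNReal (shift (L - (s + h)).toNNReal N) = shift (L - s).toNNReal N := by
      rw [shift_shift hN.mono, ← Real.toNNReal_add (by linarith) hh]
      congr 2
      ring
    have e2 : h.toNNReal + (t₀ + s).toNNReal = (t₀ + (s + h)).toNNReal := by
      rw [← Real.toNNReal_add hh (by positivity)]
      congr 1
      ring
    have e3 : (h.toNNReal : ℝ) = h := Real.coe_toNNReal h hh
    have e4 : ((t₀ + s).toNNReal : ℝ) = t₀ + s := Real.coe_toNNReal _ (by positivity)
    have e5 : b₀ + v * (s + h) - v * h = b₀ + v * s := by ring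
    have hb1 := hb (s + h) ⟨by linarith, hsh⟩
    have hb2 : v * (h.toNNReal : ℝ) ≤ b₀ + v * (s + h) := by
      rw [e3]
      linarith [hb s ⟨hs, by linarith⟩]
    have h1 := le_stayVolume_add hN' hr hv n h.toNNReal (t₀ + s).toNNReal hb1 hb2
    have h2 := stayVolume_add_le hN' hr hv n h.toNNReal (t₀ + s).toNNReal hb1 hb2
    rw [e1, e2, e3, e5] at h1 h2
    rw [e4] at h2
    have hC : Real.exp (r * (h + (t₀ + s))) * (r : ℝ) ^ 2 / (r : ℝ) ^ (n + 1) * h ^ 2 ≤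
        C * h ^ 2 := by
      simp only [C]
      rw [show h + (t₀ + s) = t₀ + (s + h) by ring]
      gcongr
    exact ⟨by simp only [f]; linarith, by simp only [f]; linarith⟩
  have hC0 : 0 ≤ C := by positivity
  have hmain : f L = u (t₀ + L) (b₀ + v * L) := by
    refine eq_of_rightDeriv_eq (g := fun s => u (t₀ + s) (b₀ + v * s))
      (K := Real.exp (r * (t₀ + L)) / r ^ n + C * L) L.coe_nonneg ?_ ?_ hu ?_
    · intro s h hs hh hsh
      obtain ⟨h1, h2⟩ := step s h hs hh hsh
      have h3 := (stayVolume_nonneg (P := P) (r := r) (N := shift (L - s).toNNReal N) (-v) n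
        (t₀ + s).toNNReal (b₀ + v * (s + h) - h))
      have h4 := (stayVolume_le (P := P) (r := r) (N := shift (L - s).toNNReal N) (-v) n
        (t₀ + s).toNNReal (b₀ + v * (s + h) + h))
      have e4 : ((t₀ + s).toNNReal : ℝ) = t₀ + s := Real.coe_toNNReal _ (by positivity)
      have h5 : Real.exp (r * (t₀ + s)) / (r : ℝ) ^ n ≤ Real.exp (r * (t₀ + L)) / (r : ℝ) ^ n := by
        gcongr
        linarith
      rw [e4] at h4
      rw [abs_of_nonneg ((mul_nonneg hh h3).trans h1)]
      have h6 := mul_le_mul_of_nonneg_left (h4.trans h5) hh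
      have h7 : C * h ^ 2 ≤ C * L * h := by
        rw [pow_two, mul_assoc]
        gcongr
        linarith
      linarith
    · intro s hs
      obtain ⟨hs1, hs2⟩ := hbt s hs
      have e4 : ((t₀ + s).toNNReal : ℝ) = t₀ + s :=
        Real.coe_toNNReal _ (add_nonneg t₀.coe_nonneg hs.1.le)
      have hclo : Continuous fun h : ℝ => b₀ + v * (s + h) - h := by fun_prop
      have hchi : Continuous fun h : ℝ => b₀ + v * (s + h) + h := by fun_prop
      have ev1 : ∀ᶠ h in 𝓝[>] (0 : ℝ), 0 < b₀ + v * (s + h) - h :=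
        (hclo.continuousAt.eventually_const_lt (by simpa using hs1)).filter_mono
          nhdsWithin_le_nhds
      have ev2 : ∀ᶠ h in 𝓝[>] (0 : ℝ), b₀ + v * (s + h) + h < t₀ + s :=
        (hchi.continuousAt.eventually_lt_const (by simpa using hs2)).filter_mono
          nhdsWithin_le_nhds
      have ev3 : ∀ᶠ h in 𝓝[>] (0 : ℝ), h ∈ Ioo 0 (L - s) := Ioo_mem_nhdsGT (sub_pos.2 hs.2)
      have hNs := hN.shift (L - s).toNNReal
      refine hasDerivWithinAt_Ici_of_squeeze
        (lo := fun h => w (t₀ + s) (b₀ + v * (s + h) - h))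
        (hi := fun h => w (t₀ + s) (b₀ + v * (s + h) + h) + C * h) ?_ ?_ ?_ ?_
      · have : Continuous fun h : ℝ => w (t₀ + s) (b₀ + v * (s + h) - h) :=
          hwc.comp (continuous_const.prodMk hclo)
        simpa using this.continuousWithinAt.tendsto (x := 0) (s := Ioi 0)
      · have : Continuous fun h : ℝ => w (t₀ + s) (b₀ + v * (s + h) + h) + C * h :=
          (hwc.comp (continuous_const.prodMk hchi)).add (by fun_prop)
        simpa using this.continuousWithinAt.tendsto (x := 0) (s := Ioi 0)
      · filter_upwards [ev1, ev2, ev3] with h h1 h2 h3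
        have := (step s h hs.1.le h3.1.le (by linarith [h3.2])).1
        rwa [hw _ hNs _ _ h1.le (by rw [e4]; linarith [h3.1]), e4] at this
      · filter_upwards [ev1, ev2, ev3] with h h1 h2 h3
        have := (step s h hs.1.le h3.1.le (by linarith [h3.2])).2
        rw [hw _ hNs _ _ (by linarith [h3.1]) (by rw [e4]; linarith [h3.1]), e4] at this
        refine this.trans_eq ?_
        ring
    · simpa [f] using h0 _ (hN.shift L)
  rw [← hmain]
  have e : ((t₀ : ℝ) + L).toNNReal = t₀ + L := by
    rw [← NNReal.coe_add, Real.toNNReal_coe]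
  simp [f, e, shift_zero hN.zero]

/-- The explicit volumes, by induction on the number of jumps along the two families of
characteristics. -/
theorem stayVolume_eq {Ω : Type*} [MeasurableSpace Ω] {P : Measure Ω}
    [IsProbabilityMeasure P] {r : ℝ≥0} (hr : 0 < r) (n : ℕ) :
    ∀ N : ℝ≥0 → Ω → ℕ, IsPoissonProcess r N P → ∀ (t : ℝ≥0) (b : ℝ), 0 ≤ b → b < t →
      stayVolume P r 1 N n t b = upVolume n t b ∧
      stayVolume P r (-1) N n t b = downVolume n t b := by
  induction n with
  | zero =>
    intro N hN t b hb hbt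
    rw [stayVolume_zero_of_lt hN hbt, stayVolume_neg_one_zero hN hb]
    simp [upVolume, downVolume]
  | succ n ih =>
    intro N hN t b hb hbt
    lift b to ℝ≥0 using hb
    have hbt' : b ≤ t := by exact_mod_cast hbt.le
    constructor
    · have h := stayVolume_eq_along_characteristic (v := 1) (t₀ := t - b) (L := b) (b₀ := 0)
        (n := n) (w := downVolume n) (u := upVolume (n + 1)) hr (by simp)
        (continuous_downVolume n) (fun N hN t b hb hbt => (ih N hN t b hb hbt).2)
        (fun s hs => by simpa using hs.1)
        (fun s hs => by
          rw [NNReal.coe_sub hbt']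
          constructor <;> linarith [hs.1])
        (fun s => by simpa using hasDerivAt_upVolume n (t - b : ℝ≥0) 0 s)
        (fun N hN => by rw [stayVolume_one_zero hN, upVolume_zero_right]) hN
      simpa [NNReal.coe_sub hbt', tsub_add_cancel_of_le hbt'] using h
    · -- The characteristic starts on the diagonal, where the level is no constraint.
      have hL : (((t - b) / 2 : ℝ≥0) : ℝ) = (t - b) / 2 := by
        rw [NNReal.coe_div, NNReal.coe_sub hbt', NNReal.coe_ofNat]
      have ht : (((t + b) / 2 : ℝ≥0) : ℝ) = (t + b) / 2 := by simp
      have e1 : (t + b) / 2 + (t - b) / 2 = t := by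
        rw [← NNReal.coe_inj, NNReal.coe_add, hL, ht]
        ring
      have h := stayVolume_eq_along_characteristic (v := -1) (t₀ := (t + b) / 2)
        (L := (t - b) / 2) (b₀ := ((t + b) / 2 : ℝ))
        (n := n) (w := upVolume n) (u := downVolume (n + 1)) hr (by simp)
        (continuous_upVolume n)
        (fun N hN t b hb hbt => by rw [neg_neg]; exact (ih N hN t b hb hbt).1)
        (fun s hs => by
          rw [hL] at hs
          linarith [hs.2, b.coe_nonneg])
        (fun s hs => by
          rw [hL] at hs
          rw [ht]
          constructor <;> linarith [hs.1, hs.2, b.coe_nonneg])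
        (fun s => by
          simpa [← sub_eq_add_neg] using
            hasDerivAt_downVolume n ((t + b) / 2 : ℝ≥0) ((t + b) / 2) s)
        (fun N hN => by
          rw [stayVolume_of_le hN hr (by simp) _ ht.le, ht, downVolume_self]) hN
      rw [e1, hL, ht] at h
      convert h using 2 <;> ring

/-! ### The distribution function of the target law -/

theorem integral_pow_sub (k : ℕ) (a y : ℝ) :
    ∫ x in (0 : ℝ)..y, (a ^ 2 - x ^ 2) ^ k = powInt k a y := by
  have h (x : ℝ) : HasDerivAt (powInt k a) ((a ^ 2 - x ^ 2) ^ k) x := by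
    simpa using hasDerivAt_powInt 0 1 a 0 k x
  rw [intervalIntegral.integral_eq_sub_of_hasDerivAt (fun x _ => h x)
    (Continuous.intervalIntegrable (by fun_prop) _ _), powInt_zero_right, sub_zero]

theorem maxLaw_Iic_of_neg (c t : ℝ) (k : ℕ) {x : ℝ} (hx : x < 0) : maxLaw c t k (Iic x) = 0 := by
  have : Iic x ∩ Ioo 0 (c * t) = ∅ :=
    eq_empty_of_forall_notMem fun y hy => by linarith [mem_Iic.1 hy.1, hy.2.1]
  rw [maxLaw, withDensity_apply _ measurableSet_Iic, Measure.restrict_restrict measurableSet_Iic,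
    this]
  simp

theorem maxLaw_Iic_of_nonneg {c t : ℝ} (hct : 0 < c * t) (k : ℕ) {x : ℝ} (hx : 0 ≤ x) :
    maxLaw c t k (Iic x) = ENNReal.ofReal (2 * (((2 * k + 1)! : ℕ) / (k ! : ℝ) ^ 2) *
      (powInt k (c * t) (min (c * t) x) / (2 * c * t) ^ (2 * k + 1))) := by
  have hset : Iic x ∩ Ioc 0 (c * t) = Ioc 0 (min (c * t) x) := by
    ext y
    simp only [mem_inter_iff, mem_Iic, mem_Ioc, le_min_iff]
    tauto
  have hnonneg : 0 ≤ min (c * t) x := le_min hct.le hx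
  have h2ct : 0 < 2 * c * t := by linarith
  rw [maxLaw, restrict_Ioo_eq_restrict_Ioc,
    withDensity_apply _ measurableSet_Iic, Measure.restrict_restrict measurableSet_Iic, hset,
    ← ofReal_integral_eq_lintegral_ofReal, ← intervalIntegral.integral_of_le hnonneg,
    intervalIntegral.integral_const_mul, intervalIntegral.integral_div]
  · simp only [← mul_pow, integral_pow_sub]
  · exact (Continuous.integrableOn_Icc (by fun_prop)).mono_set Ioc_subset_Icc_self
  · filter_upwards [ae_restrict_mem measurableSet_Ioc] with y hy
    have hy' : y ≤ c * t := hy.2.trans (min_le_left _ _)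
    have : 0 ≤ c ^ 2 * t ^ 2 - y ^ 2 := by
      rw [← mul_pow]
      exact sub_nonneg.2 (pow_le_pow_left₀ hy.1.le hy' 2)
    simp only [Pi.zero_apply]
    positivity

/-! ### The conditional law of the maximum -/

section Conditional

variable {Ω : Type*}

theorem runningMax_le_iff_of_eq {V : Ω → ℝ} {N : ℝ≥0 → Ω → ℕ} {ω : Ω} {c : ℝ} (hc : 0 < c)
    (hN : Monotone fun t => N t ω) (hV : V ω = c) (t : ℝ≥0) (x : ℝ) :
    runningMax V N t ω ≤ x ↔ runningMax (fun _ => 1) N t ω ≤ x / c := by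
  rw [runningMax_le_iff hN, runningMax_le_iff hN]
  refine forall₂_congr fun s _ => ?_
  have : position V N s ω = c * position (fun _ => 1) N s ω := by
    simp [position, hV]
  rw [this, le_div_iff₀ hc, mul_comm]

/-- Relative to the volume of all jump times, both parities give the same fraction. -/
theorem upVolume_div {n k : ℕ} (hn : n = 2 * k + 2 ∨ n = 2 * k + 1) {t : ℝ} (ht : 0 < t) (b : ℝ) :
    upVolume n t b / (t ^ n / n !) =
      (2 * k + 1)! * powInt k t b / (4 ^ k * (k ! : ℝ) ^ 2 * t ^ (2 * k + 1)) := by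
  rcases hn with rfl | rfl
  · rw [upVolume_even, Nat.factorial_succ (2 * k + 1)]
    push_cast
    field_simp
    ring
  · rw [upVolume_odd]
    field_simp

variable [MeasurableSpace Ω] {P : Measure Ω} {c : ℝ} {r : ℝ≥0}
  {V : Ω → ℝ} {N : ℝ≥0 → Ω → ℕ}

theorem measure_inter_stayBelow (hV : IsSymmetricVelocity c V P) (hN : IsPoissonProcess r N P)
    (hVN : IndepFun V (fun ω t => N t ω) P) (n : ℕ) (t : ℝ≥0) (b : ℝ) :
    P ({ω | V ω = c} ∩ stayBelow 1 N n t b) = 1 / 2 * P (stayBelow 1 N n t b) := by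
  rw [← hV.prob_pos]
  exact (IndepFun_iff _ _ _).1 hVN _ _ ⟨{c}, measurableSet_singleton c, rfl⟩
    (measurableSet_comap_stayBelow hN.mono hN.rightCont 1 n t b)

theorem measure_velocity_count (hV : IsSymmetricVelocity c V P) (hN : IsPoissonProcess r N P)
    (hVN : IndepFun V (fun ω t => N t ω) P) (n : ℕ) (t : ℝ≥0) :
    P {ω | V ω = c ∧ N t ω = n} = 1 / 2 * P {ω | N t ω = n} := by
  have := measure_inter_stayBelow hV hN hVN n t t
  rwa [stayBelow_of_le hN (by simp) n le_rfl] at this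

theorem measure_count_ne_zero (hr : 0 < r) (hN : IsPoissonProcess r N P) (n : ℕ) {t : ℝ≥0}
    (ht : 0 < t) : P {ω | N t ω = n} ≠ 0 := by
  have h1 : 0 < P.real {ω | N t ω = n} := by
    rw [hN.real_eq]
    have : 0 < (r : ℝ) := hr
    have : 0 < (t : ℝ) := ht
    positivity
  exact fun h => by simp [measureReal_def, h] at h1

theorem measurableSet_velocity_count (hV : IsSymmetricVelocity c V P) (hN : IsPoissonProcess r N P)
    (n : ℕ) (t : ℝ≥0) : MeasurableSet {ω | V ω = c ∧ N t ω = n} :=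
  (hV.measurable (measurableSet_singleton c)).inter
    (hN.measurable t (measurableSet_singleton n))

/-- Conditioning on the velocity and the count, the maximum stays below `x` with probability the
fraction of the volume of jump times for which the unit-speed motion stays below `x / c`. -/
theorem cond_runningMax_le [IsProbabilityMeasure P] (hc : 0 < c) (hr : 0 < r)
    (hV : IsSymmetricVelocity c V P) (hN : IsPoissonProcess r N P)
    (hVN : IndepFun V (fun ω t => N t ω) P) (n : ℕ) {t : ℝ≥0} (ht : 0 < t) (x : ℝ) :
    P[|{ω | V ω = c ∧ N t ω = n}] {ω | runningMax V N t ω ≤ x} =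
      ENNReal.ofReal (stayVolume P r 1 N n t (x / c) / (t ^ n / n !)) := by
  have hset : {ω | V ω = c ∧ N t ω = n} ∩ {ω | runningMax V N t ω ≤ x} =
      {ω | V ω = c} ∩ stayBelow 1 N n t (x / c) := by
    ext ω
    simp only [stayBelow, mem_inter_iff, mem_ofPred_eq, and_assoc]
    refine and_congr_right fun hVω => and_congr_right fun _ => ?_
    exact runningMax_le_iff_of_eq hc (hN.mono ω) hVω t x
  have hratio : stayVolume P r 1 N n t (x / c) / (t ^ n / n !) =
      P.real (stayBelow 1 N n t (x / c)) / P.real {ω | N t ω = n} := by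
    rw [← stayVolume_of_le hN hr (v := 1) (by simp) n le_rfl, stayVolume, stayVolume,
      stayBelow_of_le hN (by simp) n le_rfl]
    have : 0 < (r : ℝ) := hr
    exact mul_div_mul_left _ _ (by positivity)
  have hpos := measure_count_ne_zero hr hN n ht
  rw [cond_apply (measurableSet_velocity_count hV hN n t), hset,
    measure_inter_stayBelow hV hN hVN, measure_velocity_count hV hN hVN, hratio,
    measureReal_def, measureReal_def, ← ENNReal.toReal_div, ENNReal.ofReal_toReal
      (ENNReal.div_ne_top (measure_ne_top _ _) hpos),
    ENNReal.mul_inv (by simp) (by simp), mul_mul_mul_comm,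
    ENNReal.inv_mul_cancel (by simp) (by simp), one_mul, ENNReal.div_eq_inv_mul]

/-- The density of `maxLaw` is the spatial derivative of the volume fraction, and scaling space by
`c` turns the unit-speed motion into the motion of speed `c`. -/
theorem hasLaw_runningMax_cond [IsProbabilityMeasure P] (hc : 0 < c) (hr : 0 < r)
    (hV : IsSymmetricVelocity c V P) (hN : IsPoissonProcess r N P)
    (hVN : IndepFun V (fun ω t => N t ω) P) {t : ℝ≥0} (ht : 0 < t) {n k : ℕ}
    (hn : n = 2 * k + 2 ∨ n = 2 * k + 1) :
    HasLaw (runningMax V N t) (maxLaw c t k) P[|{ω | V ω = c ∧ N t ω = n}] := by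
  have hmeas := measurable_runningMax hV.measurable hN.measurable hN.mono hN.rightCont t
  refine ⟨hmeas.aemeasurable, ?_⟩
  refine Measure.ext_of_Iic _ _ fun x => ?_
  have ht' : 0 < (t : ℝ) := ht
  have hct : 0 < c * t := by positivity
  rw [Measure.map_apply hmeas measurableSet_Iic]
  refine (cond_runningMax_le hc hr hV hN hVN n ht x).trans ?_
  rcases lt_or_ge x 0 with hx | hx
  · have : stayBelow 1 N n t (x / c) = ∅ := by
      refine eq_empty_of_forall_notMem fun ω hω => ?_
      have h1 := runningMax_nonneg (V := fun _ => 1) (hN.mono ω) t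
      have h2 : x / c < 0 := div_neg_of_neg_of_pos hx hc
      linarith [hω.2]
    simp [stayVolume, this, maxLaw_Iic_of_neg c t k hx]
  rw [maxLaw_Iic_of_nonneg hct k hx]
  congr 1
  have e2 : (2 * c * t) ^ (2 * k + 1) = 2 * 4 ^ k * (c ^ (2 * k + 1) * (t : ℝ) ^ (2 * k + 1)) := by
    rw [mul_assoc, mul_pow, mul_pow, pow_succ (2 : ℝ), pow_mul (2 : ℝ),
      show (2 : ℝ) ^ 2 = 4 by norm_num]
    ring
  rcases le_or_gt (c * t) x with hxt | hxt
  · rw [min_eq_left hxt, powInt_mul,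
      stayVolume_of_le hN hr (by simp) n ((le_div_iff₀ hc).2 (by linarith)),
      div_self (by positivity), e2]
    have := powInt_self k (t : ℝ)
    field_simp
    linear_combination (-1) * this
  · rw [min_eq_right hxt.le, (stayVolume_eq hr n N hN t (x / c) (by positivity)
      ((div_lt_iff₀ hc).2 (by linarith))).1, upVolume_div hn ht', e2]
    have e3 : powInt k (c * t) x = c ^ (2 * k + 1) * powInt k t (x / c) := by
      rw [← powInt_mul, mul_div_cancel₀ _ hc.ne']
    rw [e3]
    field_simp

theorem cond_runningMax_eq [IsProbabilityMeasure P] (hc : 0 < c) (hr : 0 < r)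
    (hV : IsSymmetricVelocity c V P) (hN : IsPoissonProcess r N P)
    (hVN : IndepFun V (fun ω t => N t ω) P) {t : ℝ≥0} (ht : 0 < t) :
    P[|{ω | V ω = c ∧ N t ω = 0}] {ω | runningMax V N t ω = c * t} = 1 := by
  have hsub : {ω | V ω = c ∧ N t ω = 0} ⊆ {ω | runningMax V N t ω = c * t} := by
    rintro ω ⟨hVω, h0⟩
    refine le_antisymm ?_ ?_
    · simpa [hVω, abs_of_pos hc] using runningMax_le_mul (V := V) (hN.mono ω) t
    · have := (runningMax_le_iff (V := V) (hN.mono ω) t _).1 le_rfl t le_rfl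
      rwa [position_eq_mul_of_eq_zero (hN.mono ω) le_rfl h0, hVω] at this
  have hpos : P {ω | V ω = c ∧ N t ω = 0} ≠ 0 := by
    rw [measure_velocity_count hV hN hVN]
    simpa using measure_count_ne_zero hr hN 0 ht
  rw [cond_apply (measurableSet_velocity_count hV hN 0 t), inter_eq_left.2 hsub,
    ENNReal.inv_mul_cancel hpos (measure_ne_top _ _)]

end Conditional

end Telegraph

theorem mainTheorem2 {Ω : Type*} [MeasurableSpace Ω] (P : Measure Ω) [IsProbabilityMeasure P]
    (c : ℝ) (hc : 0 < c) (r : ℝ≥0) (hr : 0 < r)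
    (V : Ω → ℝ) (N : ℝ≥0 → Ω → ℕ)
    (hV : Telegraph.IsSymmetricVelocity c V P) (hN : Telegraph.IsPoissonProcess r N P)
    (hVN : IndepFun V (fun ω t => N t ω) P)
    (t : ℝ≥0) (ht : 0 < t) :
    (∀ k : ℕ,
      HasLaw (Telegraph.runningMax V N t) (Telegraph.maxLaw c t k)
        P[|{ω | V ω = c ∧ N t ω = 2 * k + 2}] ∧
      HasLaw (Telegraph.runningMax V N t) (Telegraph.maxLaw c t k)
        P[|{ω | V ω = c ∧ N t ω = 2 * k + 1}]) ∧
    P[|{ω | V ω = c ∧ N t ω = 0}] {ω | Telegraph.runningMax V N t ω = c * t} = 1 :=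
  ⟨fun _ => ⟨Telegraph.hasLaw_runningMax_cond hc hr hV hN hVN ht (Or.inl rfl),
    Telegraph.hasLaw_runningMax_cond hc hr hV hN hVN ht (Or.inr rfl)⟩,
    Telegraph.cond_runningMax_eq hc hr hV hN hVN ht⟩
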